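/- For a probability vector $P=(p_1,\dots,p_n)$ (that is, $n\ge 1$, $p_i\ge 0$, $\sum_i p_i=1$) and $\alpha\in(0,\infty)\setminus\{1\}$ let $H_\alpha(P)=\frac{1}{1-\alpha}\log\sum_i p_i^\alpha$ be its Rényi entropy, with $H_1(P)=-\sum_i p_i\log p_i$ and $H_\infty(P)=-\log\max_i p_i$. Let $0<\alpha_1<\alpha_2\le\infty$. (a) Let $n\ge 1$, and on an $n$-element set let $U_1=(0,\dots,0,1)$ and $U_n=(\frac1n,\dots,\frac1n)$. For every probability vector $P$ on $n$ points there is a mixture $Q=sU_1+(1-s)U_n$, $s\in[0,1]$, with $H_{\alpha_1}(Q)=H_{\alpha_1}(P)$, such that $H_{\alpha_2}(Q)\le H_{\alpha_2}(R)$ for every probability vector $R$ on $n$ points with $H_{\alpha_1}(R)=H_{\alpha_1}(P)$. That is, for fixed $H_{\alpha_1}$ the minimum of $H_{\alpha_2}$ is attained by a mixture of $U_1$ and $U_n$. (b) Let $h>0$, and put $$b=\begin{cases}0, & \alpha_1\le 1,\\[2pt] \dfrac{\alpha_2}{\alpha_2-1}\cdot\dfrac{\alpha_1-1}{\alpha_1}\,h,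 & \alpha_1>1,\end{cases}$$ where $\frac{\alpha_2}{\alpha_2-1}$ is read as $1$ if $\alpha_2=\infty$. Every probability vector $P$ of any finite length with $H_{\alpha_1}(P)=h$ satisfies $H_{\alpha_2}(P)>b$. This bound is tight: $b$ is the infimum of $H_{\alpha_2}(P)$ over all probability vectors $P$ of any finite length with $H_{\alpha_1}(P)=h$. -/

import Mathlib

open scoped ENNReal

/-- The Rényi entropy of order `α ∈ [0, ∞]` of a probability vector `p`, with the values at the
orders `0`, `1` and `∞` given by continuous extension. -/
noncomputable def renyiEntropy {n : ℕ} (α : ℝ≥0∞) (p : Fin n → ℝ) : ℝ :=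
  if α = 0 then Real.log ({i : Fin n | p i ≠ 0}.ncard : ℝ)
  else if α = 1 then -∑ i, p i * Real.log (p i)
  else if α = ∞ then -Real.log (⨆ i, p i)
  else 1 / (1 - α.toReal) * Real.log (∑ i, p i ^ α.toReal)

/-- The uniform distribution `U_k = (0, …, 0, 1/k, …, 1/k)` on the last `k` of the `n` points. -/
noncomputable def uniformDist (n k : ℕ) : Fin n → ℝ :=
  fun i => if n ≤ (i : ℕ) + k then 1 / (k : ℝ) else 0

/-- The factor `α / (α - 1)` for an order `α > 1`, with its limit `1` at `α = ∞`. -/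
noncomputable def orderRatio (α : ℝ≥0∞) : ℝ :=
  if α = ∞ then 1 else α.toReal / (α.toReal - 1)

/-- The lower bound on the entropy of order `α₂` over all finite probability vectors whose entropy
of order `α₁` equals `h`. -/
noncomputable def entropyLowerBound (α₁ α₂ : ℝ≥0∞) (h : ℝ) : ℝ :=
  if α₁ ≤ 1 then 0
  else orderRatio α₂ * ((α₁.toReal - 1) / α₁.toReal) * h

/-!
Write `φ a` for `powerKernel a`, whose second derivative is `t ^ (a - 2)`, and `D a y` for its
Bregman divergence at `y`. For a fixed total mass, `∑ φ a (p i)` and `∑ D a y (p i)` differ by a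
constant, and for a mixture with light mass `y > 0` and heavy mass `x` the latter is `D a y x`.
Take `a < b`. The function `D b y - l * D a y` has second derivative
`t ^ (a - 2) * (t ^ (b - a) - l)`, so it is first concave and then convex. It vanishes to second
order at `y`, and `l` can be chosen so that it also vanishes at `x`; then `D b y ≤ l * D a y` on
`[0, x]`. A vector whose `a`-entropy is at least that of the mixture has all its masses in `[0, x]`,
and summing this inequality over its masses compares the `b`-entropies.

For `α > 1` the entropy is `-(α / (α - 1)) * log ‖p‖_α`, and the lower bound expresses that `ℓ^α`
norms decrease strictly in `α` on vectors with two nonzero entries. For `α ≤ 1` it is positivity of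
the entropy. Mixtures on `m + 1` points with the prescribed entropy approach the bound as `m → ∞`:
the light masses lose their influence on entropies of larger orders, and the heavy mass tends to
`1` if `α₁ ≤ 1` and to `exp (-(α₁ - 1) / α₁ * h)` if `α₁ > 1`.
-/

open Filter Topology

section Convexity

variable {s : Set ℝ} {f : ℝ → ℝ} {c u x y t : ℝ}

theorem strictConvexOn_of_hasDerivAt2_pos {f' f'' : ℝ → ℝ} (hs : Convex ℝ s)
    (hf : ContinuousOn f s) (hf' : ∀ x ∈ interior s, HasDerivAt f (f' x) x)
    (hf'' : ∀ x ∈ interior s, HasDerivAt f' (f'' x) x) (hpos : ∀ x ∈ interior s, 0 < f'' x) :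
    StrictConvexOn ℝ s f := by
  refine strictConvexOn_of_deriv2_pos hs hf fun x hx => ?_
  have hderiv : deriv f =ᶠ[𝓝 x] f' :=
    eventually_of_mem (isOpen_interior.mem_nhds hx) fun z hz => (hf' z hz).deriv
  rw [Function.iterate_succ_apply, Function.iterate_one, hderiv.deriv_eq, (hf'' x hx).deriv]
  exact hpos x hx

theorem lt_of_strictConvexOn_of_hasDerivAt_zero (hf : StrictConvexOn ℝ s f) (hx : x ∈ s)
    (ht : t ∈ s) (hne : t ≠ x) (hderiv : HasDerivAt f 0 x) : f x < f t := by
  rcases lt_or_gt_of_ne hne with htx | hxt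
  · have hslope := hf.slope_lt_of_hasDerivAt ht hx htx hderiv
    rw [slope_def_field, div_lt_iff₀ (sub_pos.2 htx)] at hslope
    linarith
  · have hslope := hf.lt_slope_of_hasDerivAt hx ht hxt hderiv
    rw [slope_def_field, lt_div_iff₀ (sub_pos.2 hxt)] at hslope
    linarith

theorem le_of_strictConcaveOn_of_hasDerivAt_zero (hf : StrictConcaveOn ℝ s f) (hx : x ∈ s)
    (ht : t ∈ s) (hderiv : HasDerivAt f 0 x) : f t ≤ f x := by
  rcases eq_or_ne t x with rfl | hne
  · exact le_rfl
  · have hderiv' : HasDerivAt (-f) 0 x := by simpa using hderiv.neg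
    simpa using (lt_of_strictConvexOn_of_hasDerivAt_zero hf.neg hx ht hne hderiv').le

theorem strictMonoOn_Ici_of_strictConvexOn_of_hasDerivAt_zero (hf : StrictConvexOn ℝ s f)
    (hs : Set.Ici x ⊆ s) (hderiv : HasDerivAt f 0 x) : StrictMonoOn f (Set.Ici x) := by
  intro v hv w hw hvw
  have hxw : x < w := lt_of_le_of_lt hv hvw
  have hfxw := lt_of_strictConvexOn_of_hasDerivAt_zero hf (hs (Set.mem_Ici.2 le_rfl)) (hs hw)
    hxw.ne' hderiv
  rcases (Set.mem_Ici.1 hv).eq_or_lt with rfl | hxv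
  · exact hfxw
  · have hmax := hf.lt_on_openSegment (hs (Set.mem_Ici.2 le_rfl)) (hs hw) hxw.ne
      (z := v) (by rw [openSegment_eq_Ioo hxw]; exact ⟨hxv, hvw⟩)
    exact hmax.trans_eq (max_eq_right hfxw.le)

theorem le_of_strictConcaveOn_Icc_of_strictConvexOn_Ici (hconc : StrictConcaveOn ℝ (Set.Icc u c) f)
    (hconv : StrictConvexOn ℝ (Set.Ici c) f) (huy : u ≤ y) (hyx : y < x)
    (hderiv : HasDerivAt f 0 y) (hxy : f x = f y) (ht : t ∈ Set.Icc u x) : f t ≤ f y := by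
  have hyc : y < c := by
    by_contra! hcy
    exact (lt_of_strictConvexOn_of_hasDerivAt_zero hconv hcy (hcy.trans hyx.le) hyx.ne'
      hderiv).ne' hxy
  have left : ∀ v ∈ Set.Icc u c, f v ≤ f y := fun v hv =>
    le_of_strictConcaveOn_of_hasDerivAt_zero hconc ⟨huy, hyc.le⟩ hv hderiv
  rcases le_total t c with htc | hct
  · exact left t ⟨ht.1, htc⟩
  · calc f t ≤ max (f c) (f x) :=
          hconv.convexOn.le_max_of_mem_Icc (Set.mem_Ici.2 le_rfl) (hct.trans ht.2) ⟨hct, ht.2⟩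
      _ ≤ f y := max_le (left c ⟨huy.trans hyc.le, le_rfl⟩) hxy.le

end Convexity

/-- The convex function `t ^ a / (a * (a - 1))`, read as `t * log t` at `a = 1`. It is normalized
so that its second derivative is `t ^ (a - 2)` for every order `a`, and the Rényi entropy of order
`a` is a decreasing function of its sum over the masses. -/
noncomputable def powerKernel (a t : ℝ) : ℝ :=
  if a = 1 then t * Real.log t else t ^ a / (a * (a - 1))

/-- The derivative of `powerKernel a` on the positive half-line. -/
noncomputable def powerKernelDeriv (a t : ℝ) : ℝ :=
  if a = 1 then Real.log t + 1 else t ^ (a - 1) / (a - 1)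

/-- The Bregman divergence of `powerKernel a`: the height at `t` of its graph above its tangent
at `y`. -/
noncomputable def powerDivergence (a y t : ℝ) : ℝ :=
  powerKernel a t - powerKernel a y - powerKernelDeriv a y * (t - y)

section PowerKernel

variable {a b c x y t : ℝ}

theorem powerKernel_zero (ha : a ≠ 0) : powerKernel a 0 = 0 := by
  simp [powerKernel, Real.zero_rpow ha]

theorem continuous_powerKernel (ha : 0 < a) : Continuous (powerKernel a) := by
  unfold powerKernel
  by_cases h : a = 1
  · simpa only [h, if_true] using Real.continuous_mul_log
  · simpa only [h, if_false] using (Real.continuous_rpow_const ha.le).div_const _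

theorem hasDerivAt_powerKernel (ha : a ≠ 0) (ht : 0 < t) :
    HasDerivAt (powerKernel a) (powerKernelDeriv a t) t := by
  unfold powerKernel powerKernelDeriv
  by_cases h : a = 1
  · simpa only [h, if_true] using Real.hasDerivAt_mul_log ht.ne'
  · simp only [h, if_false]
    refine ((Real.hasDerivAt_rpow_const (p := a) (.inl ht.ne')).div_const _).congr_deriv ?_
    have := sub_ne_zero.2 h
    field_simp

theorem hasDerivAt_powerKernelDeriv (ht : 0 < t) :
    HasDerivAt (powerKernelDeriv a) (t ^ (a - 2)) t := by
  unfold powerKernelDeriv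
  by_cases h : a = 1
  · subst h
    simp only [if_true]
    refine ((Real.hasDerivAt_log ht.ne').add_const 1).congr_deriv ?_
    rw [← Real.rpow_neg_one]
    norm_num
  · simp only [h, if_false]
    refine ((Real.hasDerivAt_rpow_const (p := a - 1) (.inl ht.ne')).div_const _).congr_deriv ?_
    rw [mul_div_cancel_left₀ _ (sub_ne_zero.2 h)]
    ring_nf

theorem strictConvexOn_powerKernel (ha : 0 < a) : StrictConvexOn ℝ (Set.Ici 0) (powerKernel a) := by
  refine strictConvexOn_of_hasDerivAt2_pos (f' := powerKernelDeriv a)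
    (f'' := fun t => t ^ (a - 2)) (convex_Ici 0) (continuous_powerKernel ha).continuousOn
    ?_ ?_ ?_ <;> intro t ht <;> rw [interior_Ici, Set.mem_Ioi] at ht
  · exact hasDerivAt_powerKernel ha.ne' ht
  · exact hasDerivAt_powerKernelDeriv ht
  · exact Real.rpow_pos_of_pos ht _

theorem powerKernel_lt_mul (ha : 0 < a) (h0 : 0 < t) (h1 : t < 1) :
    powerKernel a t < t * powerKernel a 1 := by
  simpa [powerKernel_zero ha.ne'] using (strictConvexOn_powerKernel ha).2 (Set.mem_Ici.2 le_rfl)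
    (Set.mem_Ici.2 zero_le_one) zero_ne_one (sub_pos.2 h1) h0 (sub_add_cancel 1 t)

theorem powerDivergence_self (a y : ℝ) : powerDivergence a y y = 0 := by
  simp [powerDivergence]

theorem continuous_powerDivergence (ha : 0 < a) (y : ℝ) : Continuous (powerDivergence a y) := by
  have := continuous_powerKernel ha
  unfold powerDivergence
  fun_prop

theorem hasDerivAt_powerDivergence (ha : a ≠ 0) (y : ℝ) (ht : 0 < t) :
    HasDerivAt (powerDivergence a y) (powerKernelDeriv a t - powerKernelDeriv a y) t :=
  (((hasDerivAt_powerKernel ha ht).sub_const (powerKernel a y)).sub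
    (((hasDerivAt_id t).sub_const y).const_mul (powerKernelDeriv a y))).congr_deriv (by simp)

theorem hasDerivAt_powerDivergence_self (ha : a ≠ 0) (hy : 0 < y) :
    HasDerivAt (powerDivergence a y) 0 y := by
  simpa using hasDerivAt_powerDivergence ha y hy

theorem strictConvexOn_powerDivergence (ha : 0 < a) (y : ℝ) :
    StrictConvexOn ℝ (Set.Ici 0) (powerDivergence a y) := by
  refine strictConvexOn_of_hasDerivAt2_pos (f'' := fun t => t ^ (a - 2)) (convex_Ici 0)
    (continuous_powerDivergence ha y).continuousOn
    (f' := fun t => powerKernelDeriv a t - powerKernelDeriv a y)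
    ?_ ?_ ?_ <;> intro t ht <;> rw [interior_Ici, Set.mem_Ioi] at ht
  · exact hasDerivAt_powerDivergence ha.ne' y ht
  · exact (hasDerivAt_powerKernelDeriv ht).sub_const _
  · exact Real.rpow_pos_of_pos ht _

theorem powerDivergence_pos (ha : 0 < a) (hy : 0 < y) (ht : 0 ≤ t) (hne : t ≠ y) :
    0 < powerDivergence a y t :=
  powerDivergence_self a y ▸ lt_of_strictConvexOn_of_hasDerivAt_zero
    (strictConvexOn_powerDivergence ha y) hy.le ht hne (hasDerivAt_powerDivergence_self ha.ne' hy)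

theorem powerDivergence_nonneg (ha : 0 < a) (hy : 0 < y) (ht : 0 ≤ t) :
    0 ≤ powerDivergence a y t := by
  rcases eq_or_ne t y with rfl | hne
  · exact (powerDivergence_self a t).ge
  · exact (powerDivergence_pos ha hy ht hne).le

theorem strictMonoOn_powerDivergence (ha : 0 < a) (hy : 0 < y) :
    StrictMonoOn (powerDivergence a y) (Set.Ici y) :=
  strictMonoOn_Ici_of_strictConvexOn_of_hasDerivAt_zero (strictConvexOn_powerDivergence ha y)
    (Set.Ici_subset_Ici.2 hy.le) (hasDerivAt_powerDivergence_self ha.ne' hy)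

theorem continuous_powerDivergence_sub (ha : 0 < a) (hb : 0 < b) (y l : ℝ) :
    Continuous fun t => powerDivergence b y t - l * powerDivergence a y t :=
  (continuous_powerDivergence hb y).sub ((continuous_powerDivergence ha y).const_mul l)

theorem hasDerivAt_powerDivergence_sub (ha : a ≠ 0) (hb : b ≠ 0) (y l : ℝ) (ht : 0 < t) :
    HasDerivAt (fun t => powerDivergence b y t - l * powerDivergence a y t)
      (powerKernelDeriv b t - powerKernelDeriv b y
        - l * (powerKernelDeriv a t - powerKernelDeriv a y)) t :=
  (hasDerivAt_powerDivergence hb y ht).sub ((hasDerivAt_powerDivergence ha y ht).const_mul l)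

theorem hasDerivAt_powerKernelDeriv_sub (y l : ℝ) (ht : 0 < t) :
    HasDerivAt (fun t => powerKernelDeriv b t - powerKernelDeriv b y
        - l * (powerKernelDeriv a t - powerKernelDeriv a y))
      (t ^ (a - 2) * (t ^ (b - a) - l)) t := by
  refine (((hasDerivAt_powerKernelDeriv ht).sub_const _).sub
    (((hasDerivAt_powerKernelDeriv ht).sub_const _).const_mul l)).congr_deriv ?_
  rw [mul_sub, ← Real.rpow_add ht]
  ring_nf

theorem strictConvexOn_powerDivergence_sub (ha : 0 < a) (hab : a < b) (y : ℝ) (hc : 0 ≤ c) :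
    StrictConvexOn ℝ (Set.Ici c)
      fun t => powerDivergence b y t - c ^ (b - a) * powerDivergence a y t := by
  have hb := ha.trans hab
  refine strictConvexOn_of_hasDerivAt2_pos
    (f'' := fun t => t ^ (a - 2) * (t ^ (b - a) - c ^ (b - a)))
    (f' := fun t => powerKernelDeriv b t - powerKernelDeriv b y
        - c ^ (b - a) * (powerKernelDeriv a t - powerKernelDeriv a y)) (convex_Ici c)
    (continuous_powerDivergence_sub ha hb y _).continuousOn
    ?_ ?_ ?_ <;> intro t ht <;> rw [interior_Ici, Set.mem_Ioi] at ht
  · exact hasDerivAt_powerDivergence_sub ha.ne' hb.ne' y _ (hc.trans_lt ht)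
  · exact hasDerivAt_powerKernelDeriv_sub y _ (hc.trans_lt ht)
  · exact mul_pos (Real.rpow_pos_of_pos (hc.trans_lt ht) _)
      (sub_pos.2 (Real.rpow_lt_rpow hc ht (sub_pos.2 hab)))

theorem strictConcaveOn_powerDivergence_sub (ha : 0 < a) (hab : a < b) (y c : ℝ) :
    StrictConcaveOn ℝ (Set.Icc 0 c)
      fun t => powerDivergence b y t - c ^ (b - a) * powerDivergence a y t := by
  have hb := ha.trans hab
  refine neg_strictConvexOn_iff.1 (strictConvexOn_of_hasDerivAt2_pos
    (f'' := fun t => -(t ^ (a - 2) * (t ^ (b - a) - c ^ (b - a))))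
    (f' := fun t => -(powerKernelDeriv b t - powerKernelDeriv b y
        - c ^ (b - a) * (powerKernelDeriv a t - powerKernelDeriv a y))) (convex_Icc 0 c)
    (continuous_powerDivergence_sub ha hb y _).neg.continuousOn
    ?_ ?_ ?_) <;> intro t ht <;> rw [interior_Icc, Set.mem_Ioo] at ht
  · exact (hasDerivAt_powerDivergence_sub ha.ne' hb.ne' y _ ht.1).neg
  · exact (hasDerivAt_powerKernelDeriv_sub y _ ht.1).neg
  · exact neg_pos.2 (mul_neg_of_pos_of_neg (Real.rpow_pos_of_pos ht.1 _)
      (sub_neg.2 (Real.rpow_lt_rpow ht.1.le ht.2 (sub_pos.2 hab))))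

theorem exists_powerDivergence_le_mul (ha : 0 < a) (hab : a < b) (hy : 0 < y) (hyx : y ≤ x) :
    ∃ l, 0 ≤ l ∧ powerDivergence b y x = l * powerDivergence a y x ∧
      ∀ t ∈ Set.Icc 0 x, powerDivergence b y t ≤ l * powerDivergence a y t := by
  have hb := ha.trans hab
  have hcrit : ∀ l, HasDerivAt (fun t => powerDivergence b y t - l * powerDivergence a y t) 0 y :=
    fun l => by simpa using hasDerivAt_powerDivergence_sub ha.ne' hb.ne' y l hy
  have hself : ∀ l, powerDivergence b y y - l * powerDivergence a y y = 0 := fun l => by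
    simp [powerDivergence_self]
  rcases hyx.eq_or_lt with rfl | hlt
  · refine ⟨y ^ (b - a), by positivity, by simp [powerDivergence_self], fun t ht => ?_⟩
    exact sub_nonpos.1 <| (le_of_strictConcaveOn_of_hasDerivAt_zero
      (strictConcaveOn_powerDivergence_sub ha hab y y) ⟨hy.le, le_rfl⟩ ht (hcrit _)).trans_eq
      (hself _)
  have hA := powerDivergence_pos ha hy (hy.trans hlt).le hlt.ne'
  have hB := powerDivergence_pos hb hy (hy.trans hlt).le hlt.ne'
  obtain ⟨c, hc, hcl⟩ :
      ∃ c, 0 ≤ c ∧ c ^ (b - a) = powerDivergence b y x / powerDivergence a y x :=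
    ⟨_, by positivity, Real.rpow_inv_rpow (div_pos hB hA).le (sub_pos.2 hab).ne'⟩
  have hlx : powerDivergence b y x = c ^ (b - a) * powerDivergence a y x := by
    rw [hcl, div_mul_cancel₀ _ hA.ne']
  refine ⟨c ^ (b - a), by positivity, hlx, fun t ht => sub_nonpos.1 ?_⟩
  exact (le_of_strictConcaveOn_Icc_of_strictConvexOn_Ici
    (strictConcaveOn_powerDivergence_sub ha hab y c)
    (strictConvexOn_powerDivergence_sub ha hab y hc) hy.le hlt (hcrit _)
    (by rw [hself, sub_eq_zero.2 hlx]) ht).trans_eq (hself _)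

end PowerKernel

section Simplex

variable {ι : Type*} [Fintype ι] {p q : ι → ℝ} {a y : ℝ}

theorem exists_pos_of_mem_stdSimplex (hp : p ∈ stdSimplex ℝ ι) : ∃ i, 0 < p i := by
  by_contra! h
  linarith [hp.2, Finset.sum_nonpos fun i (_ : i ∈ Finset.univ) => h i]

theorem eq_single_of_one_le [DecidableEq ι] (hp : p ∈ stdSimplex ℝ ι) {i : ι} (hi : 1 ≤ p i) :
    p = Pi.single i 1 := by
  have hpi : p i = 1 := hi.antisymm' ((mem_Icc_of_mem_stdSimplex hp i).2)
  have hrest : ∑ j ∈ Finset.univ.erase i, p j = 0 := by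
    linarith [hp.2, Finset.add_sum_erase Finset.univ p (Finset.mem_univ i)]
  funext j
  rcases eq_or_ne j i with rfl | hj
  · rw [Pi.single_eq_same, hpi]
  · rw [Pi.single_eq_of_ne hj]
    exact (Finset.sum_eq_zero_iff_of_nonneg fun k _ => hp.1 k).1 hrest j (by simp [hj])

theorem sum_rpow_pos (hp : p ∈ stdSimplex ℝ ι) (a : ℝ) : 0 < ∑ i, p i ^ a := by
  obtain ⟨i, hi⟩ := exists_pos_of_mem_stdSimplex hp
  exact Finset.sum_pos' (fun j _ => Real.rpow_nonneg (hp.1 j) a)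
    ⟨i, Finset.mem_univ i, Real.rpow_pos_of_pos hi a⟩

theorem sum_powerKernel_of_ne_one (ha : a ≠ 1) (p : ι → ℝ) :
    ∑ i, powerKernel a (p i) = (∑ i, p i ^ a) / (a * (a - 1)) := by
  simp [powerKernel, ha, Finset.sum_div]

theorem sum_powerKernel_lt (ha : 0 < a) (hp : p ∈ stdSimplex ℝ ι) (hlt : ∀ i, p i < 1) :
    ∑ i, powerKernel a (p i) < powerKernel a 1 := by
  obtain ⟨k, hk⟩ := exists_pos_of_mem_stdSimplex hp
  calc ∑ i, powerKernel a (p i) < ∑ i, p i * powerKernel a 1 := by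
        refine Finset.sum_lt_sum (fun i _ => ?_)
          ⟨k, Finset.mem_univ k, powerKernel_lt_mul ha hk (hlt k)⟩
        rcases (hp.1 i).eq_or_lt with hi | hi
        · simp [← hi, powerKernel_zero ha.ne']
        · exact (powerKernel_lt_mul ha hi (hlt i)).le
    _ = powerKernel a 1 := by rw [← Finset.sum_mul, hp.2, one_mul]

theorem sum_powerDivergence (hp : p ∈ stdSimplex ℝ ι) (a y : ℝ) :
    ∑ i, powerDivergence a y (p i) = ∑ i, powerKernel a (p i) -
      (Fintype.card ι * powerKernel a y + powerKernelDeriv a y * (1 - Fintype.card ι * y)) := by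
  simp only [powerDivergence, Finset.sum_sub_distrib, ← Finset.mul_sum, hp.2, Finset.sum_const,
    Finset.card_univ, nsmul_eq_mul]
  ring

theorem sum_powerDivergence_le_iff (hp : p ∈ stdSimplex ℝ ι) (hq : q ∈ stdSimplex ℝ ι) (a y : ℝ) :
    ∑ i, powerDivergence a y (p i) ≤ ∑ i, powerDivergence a y (q i) ↔
      ∑ i, powerKernel a (p i) ≤ ∑ i, powerKernel a (q i) := by
  rw [sum_powerDivergence hp, sum_powerDivergence hq, sub_le_sub_iff_right]

theorem mul_sum_mul_log_le_log_sum_rpow (hp : p ∈ stdSimplex ℝ ι) (a : ℝ) :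
    (a - 1) * ∑ i, p i * Real.log (p i) ≤ Real.log (∑ i, p i ^ a) := by
  set S := ∑ i, p i ^ a with hS
  have hSpos : 0 < S := sum_rpow_pos hp a
  have gibbs : ∀ i, p i * ((a - 1) * Real.log (p i) - Real.log S) ≤ p i ^ a / S - p i := by
    intro i
    rcases (hp.1 i).eq_or_lt with hi | hi
    · simpa [← hi] using div_nonneg (Real.rpow_nonneg le_rfl a) hSpos.le
    · have hlog := Real.log_le_sub_one_of_pos (div_pos (Real.rpow_pos_of_pos hi (a - 1)) hSpos)
      rw [Real.log_div (Real.rpow_pos_of_pos hi _).ne' hSpos.ne', Real.log_rpow hi] at hlog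
      calc p i * ((a - 1) * Real.log (p i) - Real.log S)
          ≤ p i * (p i ^ (a - 1) / S - 1) := mul_le_mul_of_nonneg_left hlog hi.le
        _ = p i ^ a / S - p i := by
          rw [Real.rpow_sub_one hi.ne']
          field_simp
  have hsum : ∑ i, p i * ((a - 1) * Real.log (p i) - Real.log S) ≤ 0 := by
    calc ∑ i, p i * ((a - 1) * Real.log (p i) - Real.log S) ≤ ∑ i, (p i ^ a / S - p i) :=
          Finset.sum_le_sum fun i _ => gibbs i
      _ = 0 := by rw [Finset.sum_sub_distrib, ← Finset.sum_div, hp.2, ← hS, div_self hSpos.ne',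
            sub_self]
  have hsplit : ∑ i, p i * ((a - 1) * Real.log (p i) - Real.log S) =
      (a - 1) * ∑ i, p i * Real.log (p i) - Real.log S := by
    simp only [mul_sub, Finset.sum_sub_distrib, ← Finset.sum_mul, hp.2, one_mul, Finset.mul_sum,
      mul_left_comm]
  linarith

end Simplex

section Entropy

variable {n m : ℕ} {α : ℝ≥0∞} {p : Fin n → ℝ} {q : Fin m → ℝ}

theorem toReal_ne_one (h1 : α ≠ 1) : α.toReal ≠ 1 :=
  (ENNReal.toReal_eq_one_iff α).not.2 h1

theorem renyiEntropy_one (p : Fin n → ℝ) : renyiEntropy 1 p = -∑ i, p i * Real.log (p i) := by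
  simp [renyiEntropy]

theorem renyiEntropy_top (hp : p ∈ stdSimplex ℝ (Fin n)) :
    renyiEntropy ∞ p = -Real.log ‖p‖ := by
  have hsup : ⨆ i, p i = ‖p‖ := le_antisymm
    (Real.iSup_le (fun i => (Real.le_norm_self _).trans (norm_le_pi_norm p i)) (norm_nonneg p))
    ((pi_norm_le_iff_of_nonneg (Real.iSup_nonneg hp.1)).2 fun i => by
      rw [Real.norm_of_nonneg (hp.1 i)]
      exact le_ciSup (Set.finite_range p).bddAbove i)
  simp [renyiEntropy, hsup]

theorem renyiEntropy_of_ne (h0 : α ≠ 0) (h1 : α ≠ 1) (ht : α ≠ ∞) (p : Fin n → ℝ) :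
    renyiEntropy α p = 1 / (1 - α.toReal) * Real.log (∑ i, p i ^ α.toReal) := by
  simp [renyiEntropy, h0, h1, ht]

theorem norm_pos_of_mem_stdSimplex (hp : p ∈ stdSimplex ℝ (Fin n)) : 0 < ‖p‖ := by
  obtain ⟨i, hi⟩ := exists_pos_of_mem_stdSimplex hp
  exact hi.trans_le ((Real.le_norm_self _).trans (norm_le_pi_norm p i))

theorem renyiEntropy_le_iff (h0 : α ≠ 0) (ht : α ≠ ∞) (hp : p ∈ stdSimplex ℝ (Fin n))
    (hq : q ∈ stdSimplex ℝ (Fin m)) :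
    renyiEntropy α p ≤ renyiEntropy α q ↔
      ∑ i, powerKernel α.toReal (q i) ≤ ∑ i, powerKernel α.toReal (p i) := by
  by_cases h1 : α = 1
  · simp [h1, renyiEntropy_one, powerKernel]
  have ha := ENNReal.toReal_pos h0 ht
  have ha1 := toReal_ne_one h1
  have hSp := sum_rpow_pos hp α.toReal
  have hSq := sum_rpow_pos hq α.toReal
  rw [renyiEntropy_of_ne h0 h1 ht, renyiEntropy_of_ne h0 h1 ht, sum_powerKernel_of_ne_one ha1,
    sum_powerKernel_of_ne_one ha1]
  rcases lt_or_gt_of_ne ha1 with hlt | hgt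
  · rw [mul_le_mul_iff_right₀ (one_div_pos.2 (sub_pos.2 hlt)), Real.log_le_log_iff hSp hSq,
      div_le_div_right_of_neg (mul_neg_of_pos_of_neg ha (sub_neg.2 hlt))]
  · rw [mul_le_mul_left_of_neg (one_div_neg.2 (sub_neg.2 hgt)), Real.log_le_log_iff hSq hSp,
      div_le_div_iff_of_pos_right (mul_pos ha (sub_pos.2 hgt))]

theorem renyiEntropy_lt_iff (h0 : α ≠ 0) (ht : α ≠ ∞) (hp : p ∈ stdSimplex ℝ (Fin n))
    (hq : q ∈ stdSimplex ℝ (Fin m)) :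
    renyiEntropy α p < renyiEntropy α q ↔
      ∑ i, powerKernel α.toReal (q i) < ∑ i, powerKernel α.toReal (p i) := by
  rw [← not_le, ← not_le, renyiEntropy_le_iff h0 ht hq hp]

theorem renyiEntropy_single (h0 : α ≠ 0) (i : Fin n) :
    renyiEntropy α (Pi.single i 1) = 0 := by
  by_cases ht : α = ∞
  · rw [ht, renyiEntropy_top (single_mem_stdSimplex ℝ i), Pi.norm_single, norm_one, Real.log_one,
      neg_zero]
  by_cases h1 : α = 1
  · rw [h1, renyiEntropy_one, Fintype.sum_eq_single i fun j hj => by simp [hj]]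
    simp
  · rw [renyiEntropy_of_ne h0 h1 ht, Fintype.sum_eq_single i fun j hj => by
      simp [hj, Real.zero_rpow (ENNReal.toReal_pos h0 ht).ne']]
    simp

theorem renyiEntropy_pos (h0 : α ≠ 0) (hp : p ∈ stdSimplex ℝ (Fin n)) (hlt : ∀ i, p i < 1) :
    0 < renyiEntropy α p := by
  by_cases ht : α = ∞
  · rw [ht, renyiEntropy_top hp, neg_pos]
    refine Real.log_neg (norm_pos_of_mem_stdSimplex hp) ((pi_norm_lt_iff one_pos).2 fun i => ?_)
    rw [Real.norm_of_nonneg (hp.1 i)]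
    exact hlt i
  have ha := ENNReal.toReal_pos h0 ht
  have : renyiEntropy α (Pi.single (0 : Fin 1) 1) = 0 := renyiEntropy_single h0 0
  rw [← this, renyiEntropy_lt_iff h0 ht (single_mem_stdSimplex ℝ _) hp]
  simpa using sum_powerKernel_lt ha hp hlt

theorem renyiEntropy_nonneg (h0 : α ≠ 0) (hp : p ∈ stdSimplex ℝ (Fin n)) :
    0 ≤ renyiEntropy α p := by
  by_cases hlt : ∀ i, p i < 1
  · exact (renyiEntropy_pos h0 hp hlt).le
  · obtain ⟨i, hi⟩ := not_forall.1 hlt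
    rw [eq_single_of_one_le hp (not_lt.1 hi), renyiEntropy_single h0]

theorem lt_one_of_renyiEntropy_pos (h0 : α ≠ 0) (hp : p ∈ stdSimplex ℝ (Fin n))
    (hpos : 0 < renyiEntropy α p) (i : Fin n) : p i < 1 := by
  by_contra! hi
  rw [eq_single_of_one_le hp hi, renyiEntropy_single h0] at hpos
  exact hpos.false

theorem renyiEntropy_one_le (h0 : α ≠ 0) (h1 : α ≤ 1) (hp : p ∈ stdSimplex ℝ (Fin n)) :
    renyiEntropy 1 p ≤ renyiEntropy α p := by
  rcases h1.eq_or_lt with rfl | hlt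
  · exact le_rfl
  have ha : 0 < 1 - α.toReal := by
    simpa using (ENNReal.toReal_lt_toReal hlt.ne_top ENNReal.one_ne_top).2 hlt
  rw [renyiEntropy_one, renyiEntropy_of_ne h0 hlt.ne hlt.ne_top, one_div_mul_eq_div, le_div_iff₀ ha]
  linarith [mul_sum_mul_log_le_log_sum_rpow hp α.toReal]

theorem continuousOn_renyiEntropy (h0 : α ≠ 0) :
    ContinuousOn (renyiEntropy α) (stdSimplex ℝ (Fin n)) := by
  by_cases ht : α = ∞
  · subst ht
    exact (continuous_norm.continuousOn.log fun p hp =>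
      (norm_pos_of_mem_stdSimplex hp).ne').neg.congr fun p hp => renyiEntropy_top hp
  by_cases h1 : α = 1
  · subst h1
    refine Continuous.continuousOn ?_
    simp only [funext renyiEntropy_one]
    exact (continuous_finsetSum _ fun i _ =>
      Real.continuous_mul_log.comp (continuous_apply i)).neg
  · simp only [funext (renyiEntropy_of_ne h0 h1 ht)]
    refine continuousOn_const.mul (ContinuousOn.log ?_ fun p hp => (sum_rpow_pos hp _).ne')
    exact (continuous_finsetSum _ fun i _ =>
      (continuous_apply i).rpow_const fun _ => .inr ENNReal.toReal_nonneg).continuousOn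

theorem uniformDist_self (n : ℕ) : uniformDist n n = fun _ => 1 / (n : ℝ) := by
  funext i
  simp [uniformDist]

theorem uniformDist_self_mem_stdSimplex (hn : n ≠ 0) :
    uniformDist n n ∈ stdSimplex ℝ (Fin n) := by
  rw [uniformDist_self]
  exact ⟨fun _ => by positivity, by simp [hn]⟩

theorem renyiEntropy_uniformDist_self (h0 : α ≠ 0) (hn : n ≠ 0) :
    renyiEntropy α (uniformDist n n) = Real.log n := by
  have hn' : (n : ℝ) ≠ 0 := Nat.cast_ne_zero.2 hn
  by_cases ht : α = ∞
  · have : Nonempty (Fin n) := Fin.pos_iff_nonempty.1 hn.bot_lt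
    rw [ht, renyiEntropy_top (uniformDist_self_mem_stdSimplex hn), uniformDist_self,
      pi_norm_const]
    simp
  by_cases h1 : α = 1
  · simp [h1, renyiEntropy_one, uniformDist_self, hn']
  · have : 1 - α.toReal ≠ 0 := sub_ne_zero.2 (toReal_ne_one h1).symm
    rw [renyiEntropy_of_ne h0 h1 ht, uniformDist_self, Finset.sum_const, Finset.card_univ,
      Fintype.card_fin, nsmul_eq_mul, one_div (n : ℝ), Real.inv_rpow (Nat.cast_nonneg n),
      ← Real.rpow_neg (Nat.cast_nonneg n), ← Real.rpow_one_add' (Nat.cast_nonneg n) this,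
      Real.log_rpow (by positivity)]
    simp [sub_eq_add_neg] at this ⊢
    field_simp

theorem renyiEntropy_le_log (h0 : α ≠ 0) (hp : p ∈ stdSimplex ℝ (Fin n)) :
    renyiEntropy α p ≤ Real.log n := by
  have hn : n ≠ 0 := by
    obtain ⟨i, -⟩ := exists_pos_of_mem_stdSimplex hp
    exact i.pos.ne'
  by_cases ht : α = ∞
  · have hsum : 1 ≤ n * ‖p‖ := by
      simpa [hp.2] using Finset.sum_le_card_nsmul Finset.univ p ‖p‖ fun i _ =>
        (Real.le_norm_self _).trans (norm_le_pi_norm p i)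
    rw [ht, renyiEntropy_top hp, ← sub_nonneg, sub_neg_eq_add,
      ← Real.log_mul (Nat.cast_ne_zero.2 hn) (norm_pos_of_mem_stdSimplex hp).ne']
    exact Real.log_nonneg hsum
  have hu := uniformDist_self_mem_stdSimplex hn
  rw [← renyiEntropy_uniformDist_self h0 hn, renyiEntropy_le_iff h0 ht hp hu,
    ← sum_powerDivergence_le_iff hu hp _ (1 / n), uniformDist_self]
  simp only [powerDivergence_self, Finset.sum_const_zero]
  exact Finset.sum_nonneg fun i _ =>
    powerDivergence_nonneg (ENNReal.toReal_pos h0 ht) (by positivity) (hp.1 i)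

end Entropy

/-- The mixtures of the point mass at the last of `m + 1` points with the uniform distribution,
which are the candidates for the minimizers. The parameter is the mass `y` of each of the `m` light
points rather than the weight of the mixture; `y = 0` is the point mass and `y = 1 / (m + 1)` the
uniform distribution. -/
noncomputable def spikeDist (m : ℕ) (y : ℝ) : Fin (m + 1) → ℝ :=
  fun i => if i = Fin.last m then 1 - m * y else y

section SpikeDist

variable {m : ℕ} {y : ℝ}

theorem spikeDist_last (m : ℕ) (y : ℝ) : spikeDist m y (Fin.last m) = 1 - m * y := by
  simp [spikeDist]

theorem sum_spikeDist (m : ℕ) (y : ℝ) (f : ℝ → ℝ) :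
    ∑ i, f (spikeDist m y i) = m * f y + f (1 - m * y) := by
  simp [Fin.sum_univ_castSucc, spikeDist, (Fin.castSucc_lt_last _).ne]

theorem le_one_sub_mul (hy : y ∈ Set.Icc 0 (1 / (m + 1 : ℝ))) : y ≤ 1 - m * y := by
  have := (le_div_iff₀ (by positivity)).1 hy.2
  linarith

theorem spikeDist_mem_stdSimplex (hy : y ∈ Set.Icc 0 (1 / (m + 1 : ℝ))) :
    spikeDist m y ∈ stdSimplex ℝ (Fin (m + 1)) := by
  refine ⟨fun i => ?_, by simpa using sum_spikeDist m y id⟩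
  unfold spikeDist
  split_ifs
  · exact hy.1.trans (le_one_sub_mul hy)
  · exact hy.1

theorem spikeDist_zero (m : ℕ) : spikeDist m 0 = Pi.single (Fin.last m) 1 := by
  funext i
  simp [spikeDist, Pi.single_apply]

theorem spikeDist_one_div (m : ℕ) :
    spikeDist m (1 / (m + 1 : ℝ)) = uniformDist (m + 1) (m + 1) := by
  funext i
  simp only [spikeDist, uniformDist_self, Nat.cast_add_one]
  split_ifs
  · field_simp
    ring
  · rfl

theorem uniformDist_succ_one (m : ℕ) : uniformDist (m + 1) 1 = spikeDist m 0 := by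
  funext i
  have hi : m + 1 ≤ (i : ℕ) + 1 ↔ i = Fin.last m := by
    rw [Fin.ext_iff, Fin.val_last]
    omega
  simp [uniformDist, spikeDist, hi]

theorem spikeDist_mem_segment (hy : y ∈ Set.Icc 0 (1 / (m + 1 : ℝ))) :
    spikeDist m y ∈ segment ℝ (uniformDist (m + 1) 1) (uniformDist (m + 1) (m + 1)) := by
  have hy1 : (m + 1) * y ≤ 1 := by
    simpa [mul_comm] using (le_div_iff₀ (by positivity)).1 hy.2
  refine ⟨1 - (m + 1) * y, (m + 1) * y, sub_nonneg.2 hy1, mul_nonneg (by positivity) hy.1,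
    sub_add_cancel 1 _, ?_⟩
  rw [uniformDist_succ_one, ← spikeDist_one_div]
  funext i
  simp only [spikeDist, Pi.add_apply, Pi.smul_apply, smul_eq_mul]
  split_ifs <;> field_simp <;> ring

theorem continuous_spikeDist (m : ℕ) : Continuous (spikeDist m) := by
  refine continuous_pi fun i => ?_
  unfold spikeDist
  split_ifs <;> fun_prop

theorem exists_renyiEntropy_spikeDist_eq {α : ℝ≥0∞} (h0 : α ≠ 0) {h : ℝ} (hh : 0 ≤ h)
    (hlog : h ≤ Real.log (m + 1)) :
    ∃ y ∈ Set.Icc 0 (1 / (m + 1 : ℝ)), renyiEntropy α (spikeDist m y) = h := by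
  have hcont : ContinuousOn (fun y => renyiEntropy α (spikeDist m y))
      (Set.Icc 0 (1 / (m + 1 : ℝ))) :=
    (continuousOn_renyiEntropy h0).comp (continuous_spikeDist m).continuousOn fun _ hy =>
      spikeDist_mem_stdSimplex hy
  refine intermediate_value_Icc (by positivity) hcont ⟨?_, ?_⟩
  · simpa only [spikeDist_zero, renyiEntropy_single h0] using hh
  · simpa only [spikeDist_one_div, renyiEntropy_uniformDist_self h0 m.succ_ne_zero,
      Nat.cast_add_one] using hlog

-- Relative to the light mass `y`, only the spike has a nonzero divergence.
theorem sum_powerDivergence_spikeDist (a : ℝ) (m : ℕ) (y : ℝ) :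
    ∑ i, powerDivergence a y (spikeDist m y i) = powerDivergence a y (1 - m * y) := by
  rw [sum_spikeDist m y (powerDivergence a y), powerDivergence_self, mul_zero, zero_add]

variable {a b : ℝ} {r : Fin (m + 1) → ℝ}

theorem le_of_sum_powerKernel_le_spikeDist (ha : 0 < a) (hy : y ∈ Set.Ioc 0 (1 / (m + 1 : ℝ)))
    (hr : r ∈ stdSimplex ℝ (Fin (m + 1)))
    (hle : ∑ i, powerKernel a (r i) ≤ ∑ i, powerKernel a (spikeDist m y i)) (k : Fin (m + 1)) :
    r k ≤ 1 - m * y := by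
  have hy' := Set.Ioc_subset_Icc_self hy
  by_contra! hk
  have hdiv : powerDivergence a y (r k) ≤ powerDivergence a y (1 - m * y) :=
    calc powerDivergence a y (r k) ≤ ∑ i, powerDivergence a y (r i) :=
          Finset.single_le_sum (f := fun i => powerDivergence a y (r i))
            (fun i _ => powerDivergence_nonneg ha hy.1 (hr.1 i)) (Finset.mem_univ k)
      _ ≤ ∑ i, powerDivergence a y (spikeDist m y i) :=
          (sum_powerDivergence_le_iff hr (spikeDist_mem_stdSimplex hy') a y).2 hle
      _ = powerDivergence a y (1 - m * y) := sum_powerDivergence_spikeDist a m y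
  exact hdiv.not_gt (strictMonoOn_powerDivergence ha hy.1 (le_one_sub_mul hy')
    ((le_one_sub_mul hy').trans hk.le) hk)

theorem sum_powerKernel_le_spikeDist (ha : 0 < a) (hab : a < b)
    (hy : y ∈ Set.Ioc 0 (1 / (m + 1 : ℝ))) (hr : r ∈ stdSimplex ℝ (Fin (m + 1)))
    (hle : ∑ i, powerKernel a (r i) ≤ ∑ i, powerKernel a (spikeDist m y i)) :
    ∑ i, powerKernel b (r i) ≤ ∑ i, powerKernel b (spikeDist m y i) := by
  have hy' := Set.Ioc_subset_Icc_self hy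
  have hQ := spikeDist_mem_stdSimplex hy'
  obtain ⟨l, hl, hspike, hbound⟩ := exists_powerDivergence_le_mul ha hab hy.1 (le_one_sub_mul hy')
  rw [← sum_powerDivergence_le_iff hr hQ b y]
  calc ∑ i, powerDivergence b y (r i) ≤ ∑ i, l * powerDivergence a y (r i) :=
        Finset.sum_le_sum fun i _ =>
          hbound _ ⟨hr.1 i, le_of_sum_powerKernel_le_spikeDist ha hy hr hle i⟩
    _ = l * ∑ i, powerDivergence a y (r i) := (Finset.mul_sum _ _ _).symm
    _ ≤ l * ∑ i, powerDivergence a y (spikeDist m y i) :=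
        mul_le_mul_of_nonneg_left ((sum_powerDivergence_le_iff hr hQ a y).2 hle) hl
    _ = ∑ i, powerDivergence b y (spikeDist m y i) := by
        rw [sum_powerDivergence_spikeDist, sum_powerDivergence_spikeDist, hspike]

theorem renyiEntropy_spikeDist_le {α β : ℝ≥0∞} (h0 : 0 < α) (hαβ : α < β)
    (hy : y ∈ Set.Icc 0 (1 / (m + 1 : ℝ))) (hr : r ∈ stdSimplex ℝ (Fin (m + 1)))
    (hle : renyiEntropy α (spikeDist m y) ≤ renyiEntropy α r) :
    renyiEntropy β (spikeDist m y) ≤ renyiEntropy β r := by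
  have hβ : β ≠ 0 := (h0.trans hαβ).ne'
  have hQ := spikeDist_mem_stdSimplex hy
  rcases hy.1.eq_or_lt with rfl | hy0
  · rw [spikeDist_zero, renyiEntropy_single hβ]
    exact renyiEntropy_nonneg hβ hr
  have ha := ENNReal.toReal_pos h0.ne' hαβ.ne_top
  have hsum := (renyiEntropy_le_iff h0.ne' hαβ.ne_top hQ hr).1 hle
  by_cases ht : β = ∞
  · rw [ht, renyiEntropy_top hQ, renyiEntropy_top hr, neg_le_neg_iff]
    refine Real.log_le_log (norm_pos_of_mem_stdSimplex hr)
      ((pi_norm_le_iff_of_nonneg (norm_nonneg _)).2 fun k => ?_)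
    calc ‖r k‖ = r k := Real.norm_of_nonneg (hr.1 k)
      _ ≤ 1 - m * y := le_of_sum_powerKernel_le_spikeDist ha ⟨hy0, hy.2⟩ hr hsum k
      _ ≤ ‖spikeDist m y (Fin.last m)‖ := spikeDist_last m y ▸ Real.le_norm_self _
      _ ≤ ‖spikeDist m y‖ := norm_le_pi_norm _ _
  · exact (renyiEntropy_le_iff hβ ht hQ hr).2 (sum_powerKernel_le_spikeDist ha
      ((ENNReal.toReal_lt_toReal hαβ.ne_top ht).2 hαβ) ⟨hy0, hy.2⟩ hr hsum)

theorem exists_mem_segment_forall_renyiEntropy_le {n : ℕ} {α : ℝ≥0∞} (h0 : 0 < α)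
    {p : Fin n → ℝ} (hp : p ∈ stdSimplex ℝ (Fin n)) :
    ∃ q ∈ segment ℝ (uniformDist n 1) (uniformDist n n),
      q ∈ stdSimplex ℝ (Fin n) ∧ renyiEntropy α q = renyiEntropy α p ∧
      ∀ β > α, ∀ r ∈ stdSimplex ℝ (Fin n), renyiEntropy α p ≤ renyiEntropy α r →
        renyiEntropy β q ≤ renyiEntropy β r := by
  obtain ⟨m, rfl⟩ : ∃ m, n = m + 1 := by
    obtain ⟨i, -⟩ := exists_pos_of_mem_stdSimplex hp
    exact Nat.exists_eq_add_one.2 i.pos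
  obtain ⟨y, hy, hyp⟩ := exists_renyiEntropy_spikeDist_eq h0.ne' (renyiEntropy_nonneg h0.ne' hp)
    (by simpa only [Nat.cast_add_one] using renyiEntropy_le_log h0.ne' hp)
  exact ⟨spikeDist m y, spikeDist_mem_segment hy, spikeDist_mem_stdSimplex hy, hyp,
    fun β hβ r hr hle => renyiEntropy_spikeDist_le h0 hβ hy hr (hyp ▸ hle)⟩

end SpikeDist

section LpNorm

variable {ι : Type*} [Fintype ι] {E : ι → Type*} [∀ i, NormedAddCommGroup (E i)]
  {α β : ℝ≥0∞} {x : ∀ i, E i} {j k : ι}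

theorem norm_toLp_rpow_toReal (h0 : α ≠ 0) (ht : α ≠ ∞) (x : ∀ i, E i) :
    ‖WithLp.toLp α x‖ ^ α.toReal = ∑ i, ‖x i‖ ^ α.toReal := by
  have ha := ENNReal.toReal_pos h0 ht
  rw [PiLp.norm_eq_sum ha, one_div, Real.rpow_inv_rpow
    (Finset.sum_nonneg fun i _ => by positivity) ha.ne']

theorem norm_toLp_nonneg (h0 : α ≠ 0) (ht : α ≠ ∞) (x : ∀ i, E i) : 0 ≤ ‖WithLp.toLp α x‖ := by
  rw [PiLp.norm_eq_sum (ENNReal.toReal_pos h0 ht)]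
  positivity

theorem norm_apply_lt_norm_toLp (h0 : α ≠ 0) (ht : α ≠ ∞) (hjk : j ≠ k) (hj : x j ≠ 0) :
    ‖x k‖ < ‖WithLp.toLp α x‖ := by
  rw [← Real.rpow_lt_rpow_iff (norm_nonneg _) (norm_toLp_nonneg h0 ht x)
    (ENNReal.toReal_pos h0 ht), norm_toLp_rpow_toReal h0 ht]
  exact Finset.single_lt_sum (f := fun i => ‖x i‖ ^ α.toReal) hjk (Finset.mem_univ k)
    (Finset.mem_univ j) (Real.rpow_pos_of_pos (norm_pos_iff.2 hj) _) fun i _ _ => by positivity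

theorem norm_toLp_lt_norm_toLp (h0 : 0 < α) (hαβ : α < β) (hjk : j ≠ k) (hj : x j ≠ 0)
    (hk : x k ≠ 0) : ‖WithLp.toLp β x‖ < ‖WithLp.toLp α x‖ := by
  have hlt : ∀ i, ‖x i‖ < ‖WithLp.toLp α x‖ := fun i => by
    rcases eq_or_ne j i with rfl | hji
    · exact norm_apply_lt_norm_toLp h0.ne' hαβ.ne_top hjk.symm hk
    · exact norm_apply_lt_norm_toLp h0.ne' hαβ.ne_top hji hj
  by_cases ht : β = ∞
  · subst ht
    have : Nonempty ι := ⟨j⟩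
    obtain ⟨i, hi⟩ := exists_eq_ciSup_of_finite (f := fun i => ‖x i‖)
    rw [PiLp.norm_eq_ciSup]
    exact hi ▸ hlt i
  have hβ := (h0.trans hαβ).ne'
  have hN := norm_toLp_nonneg h0.ne' hαβ.ne_top x
  have hab := sub_pos.2 ((ENNReal.toReal_lt_toReal hαβ.ne_top ht).2 hαβ)
  have hsplit : ∀ t : ℝ, 0 ≤ t → t ^ β.toReal = t ^ α.toReal * t ^ (β.toReal - α.toReal) :=
    fun t ht0 => by
      rw [← Real.rpow_add_of_nonneg ht0 ENNReal.toReal_nonneg hab.le, add_sub_cancel]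
  rw [← Real.rpow_lt_rpow_iff (norm_toLp_nonneg hβ ht x) hN (ENNReal.toReal_pos hβ ht),
    norm_toLp_rpow_toReal hβ ht, hsplit _ hN, norm_toLp_rpow_toReal h0.ne' hαβ.ne_top,
    Finset.sum_mul]
  simp only [hsplit _ (norm_nonneg _)]
  refine Finset.sum_lt_sum (fun i _ => ?_) ⟨j, Finset.mem_univ j, ?_⟩
  · exact mul_le_mul_of_nonneg_left (Real.rpow_le_rpow (norm_nonneg _) (hlt i).le hab.le)
      (by positivity)
  · exact mul_lt_mul_of_pos_left (Real.rpow_lt_rpow (norm_nonneg _) (hlt j) hab)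
      (Real.rpow_pos_of_pos (norm_pos_iff.2 hj) _)

end LpNorm

section LowerBound

variable {n : ℕ} {α β : ℝ≥0∞} {p : Fin n → ℝ}

theorem one_lt_toReal (h1 : 1 < α) (ht : α ≠ ∞) : 1 < α.toReal := by
  simpa using (ENNReal.toReal_lt_toReal ENNReal.one_ne_top ht).2 h1

theorem orderRatio_pos (h1 : 1 < α) : 0 < orderRatio α := by
  unfold orderRatio
  split_ifs with ht
  · exact one_pos
  · have ha := one_lt_toReal h1 ht
    exact div_pos (one_pos.trans ha) (sub_pos.2 ha)

theorem norm_toLp_pos (h1 : 1 ≤ α) (hp : p ∈ stdSimplex ℝ (Fin n)) :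
    0 < ‖WithLp.toLp α p‖ := by
  have : Fact (1 ≤ α) := ⟨h1⟩
  obtain ⟨i, hi⟩ := exists_pos_of_mem_stdSimplex hp
  exact (norm_pos_iff.2 hi.ne').trans_le (PiLp.norm_apply_le (WithLp.toLp α p) i)

theorem renyiEntropy_eq_orderRatio_mul (h1 : 1 < α) (hp : p ∈ stdSimplex ℝ (Fin n)) :
    renyiEntropy α p = orderRatio α * -Real.log ‖WithLp.toLp α p‖ := by
  by_cases ht : α = ∞
  · rw [ht, renyiEntropy_top hp, PiLp.norm_toLp, orderRatio, if_pos rfl, one_mul]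
  have ha := one_lt_toReal h1 ht
  have hnorm : ‖WithLp.toLp α p‖ = (∑ i, p i ^ α.toReal) ^ (1 / α.toReal) := by
    simp only [PiLp.norm_eq_sum (one_pos.trans ha), Real.norm_of_nonneg (hp.1 _)]
  have : 1 - α.toReal ≠ 0 := by linarith
  have : α.toReal - 1 ≠ 0 := by linarith
  rw [renyiEntropy_of_ne (one_pos.trans h1).ne' h1.ne' ht, hnorm,
    Real.log_rpow (sum_rpow_pos hp _), orderRatio, if_neg ht]
  field_simp
  ring

theorem entropyLowerBound_renyiEntropy (h1 : 1 < α) (ht : α ≠ ∞) (β : ℝ≥0∞)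
    (hp : p ∈ stdSimplex ℝ (Fin n)) :
    entropyLowerBound α β (renyiEntropy α p) = orderRatio β * -Real.log ‖WithLp.toLp α p‖ := by
  have ha := one_lt_toReal h1 ht
  have : α.toReal - 1 ≠ 0 := by linarith
  rw [entropyLowerBound, if_neg h1.not_ge, renyiEntropy_eq_orderRatio_mul h1 hp,
    orderRatio.eq_def α, if_neg ht]
  field_simp

theorem exists_ne_pos_of_lt_one (hp : p ∈ stdSimplex ℝ (Fin n)) (hlt : ∀ i, p i < 1) :
    ∃ j k, j ≠ k ∧ 0 < p j ∧ 0 < p k := by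
  obtain ⟨k, hk⟩ := exists_pos_of_mem_stdSimplex hp
  by_contra! hone
  have hsum : ∑ i, p i = p k :=
    Fintype.sum_eq_single k fun j hj => ((hone k j hj.symm hk).antisymm (hp.1 j))
  linarith [hp.2, hlt k]

theorem entropyLowerBound_lt_renyiEntropy (h0 : 0 < α) (hαβ : α < β)
    (hp : p ∈ stdSimplex ℝ (Fin n)) (hpos : 0 < renyiEntropy α p) :
    entropyLowerBound α β (renyiEntropy α p) < renyiEntropy β p := by
  have hlt := lt_one_of_renyiEntropy_pos h0.ne' hp hpos
  rcases le_or_gt α 1 with h1 | h1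
  · rw [entropyLowerBound, if_pos h1]
    exact renyiEntropy_pos (h0.trans hαβ).ne' hp hlt
  · obtain ⟨j, k, hjk, hj, hk⟩ := exists_ne_pos_of_lt_one hp hlt
    have hβ := h1.trans hαβ
    rw [entropyLowerBound_renyiEntropy h1 hαβ.ne_top β hp, renyiEntropy_eq_orderRatio_mul hβ hp]
    exact mul_lt_mul_of_pos_left (neg_lt_neg (Real.log_lt_log (norm_toLp_pos hβ.le hp)
      (norm_toLp_lt_norm_toLp h0 hαβ hjk hj.ne' hk.ne'))) (orderRatio_pos hβ)

theorem renyiEntropy_le_orderRatio_mul (h1 : 1 < α) (hp : p ∈ stdSimplex ℝ (Fin n)) {i : Fin n}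
    (hi : 0 < p i) : renyiEntropy α p ≤ orderRatio α * -Real.log (p i) := by
  have : Fact (1 ≤ α) := ⟨h1.le⟩
  have hle : p i ≤ ‖WithLp.toLp α p‖ :=
    (Real.le_norm_self _).trans (PiLp.norm_apply_le (WithLp.toLp α p) i)
  rw [renyiEntropy_eq_orderRatio_mul h1 hp]
  exact mul_le_mul_of_nonneg_left (neg_le_neg (Real.log_le_log hi hle)) (orderRatio_pos h1).le

end LowerBound

section Tightness

theorem tendsto_mul_rpow_zero {ι : Type*} {l : Filter ι} {a b C : ℝ} {w y : ι → ℝ} (ha : 0 < a)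
    (hab : a < b) (hw : ∀ i, 0 ≤ w i) (hy : ∀ i, 0 ≤ y i) (hlim : Tendsto y l (𝓝 0))
    (hC : ∀ᶠ i in l, w i * y i ^ a ≤ C) : Tendsto (fun i => w i * y i ^ b) l (𝓝 0) := by
  have hab' := sub_pos.2 hab
  have hbound : Tendsto (fun i => C * y i ^ (b - a)) l (𝓝 0) := by
    simpa [Real.zero_rpow hab'.ne'] using (hlim.rpow_const (.inr hab'.le)).const_mul C
  refine squeeze_zero' (.of_forall fun i => mul_nonneg (hw i) (Real.rpow_nonneg (hy i) _)) ?_ hbound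
  filter_upwards [hC] with i hi
  calc w i * y i ^ b = w i * y i ^ a * y i ^ (b - a) := by
        rw [mul_assoc, ← Real.rpow_add_of_nonneg (hy i) ha.le hab'.le, add_sub_cancel]
    _ ≤ C * y i ^ (b - a) := mul_le_mul_of_nonneg_right hi (Real.rpow_nonneg (hy i) _)

theorem one_sub_mul_pos {m : ℕ} {y : ℝ} (hy : y ∈ Set.Icc 0 (1 / (m + 1 : ℝ))) :
    0 < 1 - m * y := by
  rcases hy.1.eq_or_lt with rfl | hy0
  · simp
  · exact hy0.trans_le (le_one_sub_mul hy)

theorem mul_log_le_renyiEntropy_one {m : ℕ} {y : ℝ} (hy : y ∈ Set.Icc 0 (1 / (m + 1 : ℝ))) :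
    m * y * Real.log (m + 1) ≤ renyiEntropy 1 (spikeDist m y) := by
  have hmy : 0 ≤ m * y := mul_nonneg (Nat.cast_nonneg m) hy.1
  have hheavy : (1 - m * y) * Real.log (1 - m * y) ≤ 0 :=
    Real.mul_log_nonpos (one_sub_mul_pos hy).le (by linarith)
  have hlight : m * y * Real.log (m + 1) ≤ -(m * (y * Real.log y)) := by
    rcases hy.1.eq_or_lt with rfl | hy0
    · simp
    · have hlog := Real.log_le_log hy0 hy.2
      rw [one_div, Real.log_inv] at hlog
      calc m * y * Real.log (m + 1) ≤ m * y * -Real.log y :=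
            mul_le_mul_of_nonneg_left (by linarith) hmy
        _ = -(m * (y * Real.log y)) := by ring
  rw [renyiEntropy_one, sum_spikeDist m y fun t => t * Real.log t]
  linarith

/-- The sequence `y` of light masses parametrizes mixtures `spikeDist m (y m)` whose entropy of
order `α` equals `h`, which is possible only for large `m` because entropies on `m + 1` points do
not exceed `log (m + 1)`. Their entropies of larger orders tend to the lower bound. -/
structure IsSpikeSeq (α : ℝ≥0∞) (h : ℝ) (y : ℕ → ℝ) : Prop where
  mem_Icc : ∀ m : ℕ, y m ∈ Set.Icc 0 (1 / (m + 1 : ℝ))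
  eventually_renyiEntropy_eq : ∀ᶠ m in atTop, renyiEntropy α (spikeDist m (y m)) = h

theorem exists_isSpikeSeq {α : ℝ≥0∞} (h0 : α ≠ 0) {h : ℝ} (hh : 0 ≤ h) :
    ∃ y, IsSpikeSeq α h y := by
  have hex : ∀ m : ℕ, ∃ y ∈ Set.Icc 0 (1 / (m + 1 : ℝ)),
      h ≤ Real.log (m + 1) → renyiEntropy α (spikeDist m y) = h := by
    intro m
    by_cases hm : h ≤ Real.log (m + 1)
    · obtain ⟨y, hy, hyh⟩ := exists_renyiEntropy_spikeDist_eq h0 hh hm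
      exact ⟨y, hy, fun _ => hyh⟩
    · exact ⟨0, ⟨le_rfl, by positivity⟩, fun hle => absurd hle hm⟩
  choose y hy hyh using hex
  have hlog : Tendsto (fun m : ℕ => Real.log (m + 1)) atTop atTop :=
    Real.tendsto_log_atTop.comp (tendsto_atTop_add_const_right _ _ tendsto_natCast_atTop_atTop)
  exact ⟨y, hy, (hlog.eventually_ge_atTop h).mono hyh⟩

namespace IsSpikeSeq

variable {α β : ℝ≥0∞} {b h : ℝ} {y : ℕ → ℝ}

theorem mem_stdSimplex (hy : IsSpikeSeq α h y) (m : ℕ) :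
    spikeDist m (y m) ∈ stdSimplex ℝ (Fin (m + 1)) :=
  spikeDist_mem_stdSimplex (hy.mem_Icc m)

theorem tendsto_zero (hy : IsSpikeSeq α h y) : Tendsto y atTop (𝓝 0) :=
  squeeze_zero (fun m => (hy.mem_Icc m).1) (fun m => (hy.mem_Icc m).2)
    tendsto_one_div_add_atTop_nhds_zero_nat

theorem eventually_sum_rpow_eq (hy : IsSpikeSeq α h y) (h0 : α ≠ 0) (h1 : α ≠ 1) (ht : α ≠ ∞) :
    ∀ᶠ m : ℕ in atTop, m * y m ^ α.toReal + (1 - m * y m) ^ α.toReal =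
      Real.exp ((1 - α.toReal) * h) := by
  filter_upwards [hy.eventually_renyiEntropy_eq] with m hm
  have hne : 1 - α.toReal ≠ 0 := sub_ne_zero.2 (toReal_ne_one h1).symm
  rw [← sum_spikeDist m (y m) fun t => t ^ α.toReal, ← hm, renyiEntropy_of_ne h0 h1 ht,
    ← mul_assoc, mul_one_div_cancel hne, one_mul,
    Real.exp_log (sum_rpow_pos (hy.mem_stdSimplex m) _)]

theorem tendsto_mul_rpow (hy : IsSpikeSeq α h y) (h0 : α ≠ 0) (h1 : α ≠ 1) (ht : α ≠ ∞)
    (hb : α.toReal < b) : Tendsto (fun m : ℕ => m * y m ^ b) atTop (𝓝 0) := by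
  refine tendsto_mul_rpow_zero (C := Real.exp ((1 - α.toReal) * h)) (ENNReal.toReal_pos h0 ht) hb
    Nat.cast_nonneg (fun m => (hy.mem_Icc m).1) hy.tendsto_zero ?_
  filter_upwards [hy.eventually_sum_rpow_eq h0 h1 ht] with m hm
  linarith [Real.rpow_nonneg (one_sub_mul_pos (hy.mem_Icc m)).le α.toReal]

theorem tendsto_one_sub_mul_of_le_one (hy : IsSpikeSeq α h y) (h0 : α ≠ 0) (h1 : α ≤ 1) :
    Tendsto (fun m : ℕ => 1 - m * y m) atTop (𝓝 1) := by
  have hlim : Tendsto (fun m : ℕ => h / Real.log (m + 1)) atTop (𝓝 0) :=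
    (Real.tendsto_log_atTop.comp (tendsto_atTop_add_const_right _ _
      tendsto_natCast_atTop_atTop)).const_div_atTop h
  have hlight : Tendsto (fun m : ℕ => m * y m) atTop (𝓝 0) := by
    refine squeeze_zero' (.of_forall fun m => mul_nonneg (Nat.cast_nonneg m) (hy.mem_Icc m).1)
      ?_ hlim
    filter_upwards [hy.eventually_renyiEntropy_eq, eventually_gt_atTop 0] with m hm hm0
    rw [le_div_iff₀ (Real.log_pos (by simpa using hm0))]
    calc m * y m * Real.log (m + 1) ≤ renyiEntropy 1 (spikeDist m (y m)) :=
          mul_log_le_renyiEntropy_one (hy.mem_Icc m)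
      _ ≤ renyiEntropy α (spikeDist m (y m)) := renyiEntropy_one_le h0 h1 (hy.mem_stdSimplex m)
      _ = h := hm
  simpa using hlight.const_sub 1

theorem tendsto_one_sub_mul_of_one_lt (hy : IsSpikeSeq α h y) (h1 : 1 < α) (ht : α ≠ ∞) :
    Tendsto (fun m : ℕ => 1 - m * y m) atTop
      (𝓝 (Real.exp (-((α.toReal - 1) / α.toReal * h)))) := by
  have ha := one_lt_toReal h1 ht
  have ha0 : α.toReal ≠ 0 := by linarith
  have hlight : Tendsto (fun m : ℕ => m * y m ^ α.toReal) atTop (𝓝 0) :=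
    tendsto_mul_rpow_zero (C := 1) one_pos ha Nat.cast_nonneg (fun m => (hy.mem_Icc m).1)
      hy.tendsto_zero (.of_forall fun m => by
        rw [Real.rpow_one]
        linarith [one_sub_mul_pos (hy.mem_Icc m)])
  have hroot := (hlight.const_sub (Real.exp ((1 - α.toReal) * h))).rpow_const
    (p := α.toReal⁻¹) (.inr (by positivity))
  have hexponent : (1 - α.toReal) * h * α.toReal⁻¹ = -((α.toReal - 1) / α.toReal * h) := by
    field_simp
    ring
  rw [sub_zero, ← Real.exp_mul, hexponent] at hroot
  refine hroot.congr' ?_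
  filter_upwards [hy.eventually_sum_rpow_eq (one_pos.trans h1).ne' h1.ne' ht] with m hm
  rw [← hm, add_sub_cancel_left, Real.rpow_rpow_inv (one_sub_mul_pos (hy.mem_Icc m)).le ha0]

theorem tendsto_renyiEntropy_of_lt_one (hy : IsSpikeSeq α h y) (h0 : α ≠ 0) (hαβ : α < β)
    (h1 : β < 1) : Tendsto (fun m => renyiEntropy β (spikeDist m (y m))) atTop (𝓝 0) := by
  have hα1 := hαβ.trans h1
  have hlight := hy.tendsto_mul_rpow h0 hα1.ne hαβ.ne_top
    ((ENNReal.toReal_lt_toReal hαβ.ne_top h1.ne_top).2 hαβ)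
  have hheavy := (hy.tendsto_one_sub_mul_of_le_one h0 hα1.le).rpow_const (p := β.toReal)
    (.inl one_ne_zero)
  have hlim := ((hlight.add hheavy).log (by simp)).const_mul (1 / (1 - β.toReal))
  rw [Real.one_rpow, zero_add, Real.log_one, mul_zero] at hlim
  refine hlim.congr fun m => ?_
  rw [renyiEntropy_of_ne hαβ.ne_bot h1.ne h1.ne_top, sum_spikeDist m (y m) fun t => t ^ β.toReal]

theorem tendsto_renyiEntropy_of_le_one (hy : IsSpikeSeq α h y) (h0 : α ≠ 0) (hαβ : α < β)
    (h1 : β ≤ 1) : Tendsto (fun m => renyiEntropy β (spikeDist m (y m))) atTop (𝓝 0) := by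
  rcases h1.eq_or_lt with rfl | hlt
  · obtain ⟨γ, hαγ, hγ1⟩ := exists_between hαβ
    exact squeeze_zero (fun m => renyiEntropy_nonneg one_ne_zero (hy.mem_stdSimplex m))
      (fun m => renyiEntropy_one_le hαγ.ne_bot hγ1.le (hy.mem_stdSimplex m))
      (hy.tendsto_renyiEntropy_of_lt_one h0 hαγ hγ1)
  · exact hy.tendsto_renyiEntropy_of_lt_one h0 hαβ hlt

theorem tendsto_orderRatio_mul (hy : IsSpikeSeq α h y) (h0 : α ≠ 0) (ht : α ≠ ∞) (β : ℝ≥0∞) :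
    Tendsto (fun m : ℕ => orderRatio β * -Real.log (1 - m * y m)) atTop
      (𝓝 (entropyLowerBound α β h)) := by
  unfold entropyLowerBound
  split_ifs with h1
  · simpa using ((hy.tendsto_one_sub_mul_of_le_one h0 h1).log one_ne_zero).neg.const_mul
      (orderRatio β)
  · simpa [mul_assoc] using ((hy.tendsto_one_sub_mul_of_one_lt (not_le.1 h1) ht).log
      (Real.exp_ne_zero _)).neg.const_mul (orderRatio β)

theorem tendsto_renyiEntropy (hy : IsSpikeSeq α h y) (h0 : 0 < α) (hαβ : α < β) (hh : 0 < h) :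
    Tendsto (fun m => renyiEntropy β (spikeDist m (y m))) atTop
      (𝓝 (entropyLowerBound α β h)) := by
  rcases le_or_gt β 1 with h1 | h1
  · rw [entropyLowerBound, if_pos (hαβ.le.trans h1)]
    exact hy.tendsto_renyiEntropy_of_le_one h0.ne' hαβ h1
  refine tendsto_of_tendsto_of_tendsto_of_le_of_le' tendsto_const_nhds
    (hy.tendsto_orderRatio_mul h0.ne' hαβ.ne_top β) ?_ (.of_forall fun m => ?_)
  · filter_upwards [hy.eventually_renyiEntropy_eq] with m hm
    subst hm
    exact (entropyLowerBound_lt_renyiEntropy h0 hαβ (hy.mem_stdSimplex m) hh).le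
  · have hlast := spikeDist_last m (y m)
    rw [← hlast]
    exact renyiEntropy_le_orderRatio_mul h1 (hy.mem_stdSimplex m)
      (hlast ▸ one_sub_mul_pos (hy.mem_Icc m))

end IsSpikeSeq

end Tightness

theorem theorem3 (α₁ α₂ : ℝ≥0∞) (h₁ : 0 < α₁) (h₁₂ : α₁ < α₂) :
    (∀ (n : ℕ) (P : Fin n → ℝ), P ∈ stdSimplex ℝ (Fin n) →
      ∃ Q ∈ segment ℝ (uniformDist n 1) (uniformDist n n),
        Q ∈ stdSimplex ℝ (Fin n) ∧ renyiEntropy α₁ Q = renyiEntropy α₁ P ∧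
        ∀ R ∈ stdSimplex ℝ (Fin n), renyiEntropy α₁ R = renyiEntropy α₁ P →
          renyiEntropy α₂ Q ≤ renyiEntropy α₂ R) ∧
    (∀ h : ℝ, 0 < h →
      (∀ (n : ℕ) (P : Fin n → ℝ), P ∈ stdSimplex ℝ (Fin n) → renyiEntropy α₁ P = h →
        entropyLowerBound α₁ α₂ h < renyiEntropy α₂ P) ∧
      IsGLB {x : ℝ | ∃ (n : ℕ) (P : Fin n → ℝ), P ∈ stdSimplex ℝ (Fin n) ∧
          renyiEntropy α₁ P = h ∧ renyiEntropy α₂ P = x}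
        (entropyLowerBound α₁ α₂ h)) := by
  refine ⟨fun n P hP => ?_, fun h hh => ?_⟩
  · obtain ⟨Q, hQ, hQmem, hQP, hmin⟩ := exists_mem_segment_forall_renyiEntropy_le h₁ hP
    exact ⟨Q, hQ, hQmem, hQP, fun R hR hRP => hmin α₂ h₁₂ R hR hRP.ge⟩
  have hlt : ∀ (n : ℕ) (P : Fin n → ℝ), P ∈ stdSimplex ℝ (Fin n) → renyiEntropy α₁ P = h →
      entropyLowerBound α₁ α₂ h < renyiEntropy α₂ P := by
    rintro n P hP rfl
    exact entropyLowerBound_lt_renyiEntropy h₁ h₁₂ hP hh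
  obtain ⟨y, hy⟩ := exists_isSpikeSeq h₁.ne' hh.le
  refine ⟨hlt, ?_, fun c hc => ge_of_tendsto (hy.tendsto_renyiEntropy h₁ h₁₂ hh) ?_⟩
  · rintro _ ⟨n, P, hP, hPh, rfl⟩
    exact (hlt n P hP hPh).le
  · filter_upwards [hy.eventually_renyiEntropy_eq] with m hm
    exact hc ⟨m + 1, spikeDist m (y m), hy.mem_stdSimplex m, hm, rfl⟩
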